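/- Let $-\infty\le a<b\le\infty$, let $V\in L^1_{\mathrm{loc}}(a,b)$ be real-valued, let $I\subseteq\mathbb Z$, and let $M=\{x_n\}_{n\in I}\subset(a,b)$ be a set of distinct points with no accumulation point in $(a,b)$. For $\Lambda=(\alpha_n)\in\mathbb R^I$, $R=(r_n)\in(0,\infty)^I$, $\Theta=(\theta_n)\in\mathbb R^I$ put $$A_{\alpha_n,r_n,\theta_n}=\begin{pmatrix}1&\alpha_n\\0&1\end{pmatrix}\begin{pmatrix}r_n&0\\0&1/r_n\end{pmatrix}\begin{pmatrix}\cos\theta_n&-\sin\theta_n\\\sin\theta_n&\cos\theta_n\end{pmatrix}.$$ Let $\tau f=-f''+Vf$. For $z\in\mathbb C$, a solution of $(\tau_{\Lambda,R,\Theta}-z)f=0$ is a function $f$ such that $f,f'$ are (locally) absolutely continuous in $(a,b)\setminus M$, $\tau f=zf$ almost everywhere, and for all $n\in I$ the one-sided limits at $x_n$ exist and satisfy $$(f(x_n+),f'(x_n+))^T=A_{\alpha_n,r_n,\theta_n}(f(x_n-),f'(x_n-))^T;\qquad(*)$$ solutions near an endpoint are defined in the same way on a subinterval adjacent to it. The expression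 $\tau_{\Lambda,R,\Theta}$ is in the limit circle case at an endpoint if for every $z\in\mathbb C$ all solutions of $(\tau_{\Lambda,R,\Theta}-z)f=0$ are square integrable near it, and in the limit point case there if for every $z\in\mathbb C$ some solution is not. It is regular at $a$ if $a$ is finite, $V\in L^1_{\mathrm{loc}}[a,b)$ and $a$ is not an accumulation point of $M$; similarly at $b$. Write $[f,g]_x=\overline{f(x+)}g'(x+)-\overline{f'(x+)}g(x+)$, and $[f,g]_a$, $[f,g]_b$ for its limits as $x\to a+$, $x\to b-$. Fix $R$ and $\Theta$. Assume that either $\tau_{\Lambda,R,\Theta}$ is regular at $a$ (a condition independent of $\Lambda$), and then fix a non-trivial real solution $v$, near $a$, of $(\tau_{\Lambda,R,\Theta}-\lambda)v=0$ for some $\lambda\in\mathbb R$ (near $a$ this equation does not depend on $\Lambda$), or $\tau_{\Lambda,R,\Theta}$ is in the limit point case at $a$ for every $\Lambda\in\mathbb R^I$; assume the same at $b$, with a solution $w$ near $b$ in the regular case. Let $H_\Lambda$ be the operator in $L^2(a,b)$ given by $H_\Lambda f=\tau f$ on the set of all $f\in L^2(a,b)$ such that $f,f'$ are absolutely continuous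 in $(a,b)\setminus M$, $\tau f\in L^2(a,b)$, $(*)$ holds for all $n\in I$, $[v,f]_a=0$ if $\tau_{\Lambda,R,\Theta}$ is in the limit circle case at $a$, and $[w,f]_b=0$ if it is in the limit circle case at $b$. Let $\sigma_p(H_\Lambda)$ be the set of eigenvalues of $H_\Lambda$. Let $p_n$, $n\in I$, be probability measures on $\mathbb R$ that are continuous, i.e. $p_n(\{t\})=0$ for all $t\in\mathbb R$ (they need not be identical), and let $\mathbb P_1$ be the completion of the product measure $\times_{n\in I}p_n$ on $\Omega_1=\mathbb R^I$. Let $E\in\mathbb R$, let $P_{R,\Theta}(E)=\{\Lambda\in\Omega_1: E\in\sigma_p(H_\Lambda)\}$, and let $B\subseteq P_{R,\Theta}(E)$ be measurable with respect to $\mathbb P_1$. Then $\mathbb P_1(B)=0$ or $P_{R,\Theta}(E)=\Omega_1$. -/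

import Mathlib

open MeasureTheory Filter Topology

/-- The real points strictly between two extended real numbers. -/
def eIoo (c d : EReal) : Set ℝ := {t : ℝ | c < (t : EReal) ∧ (t : EReal) < d}

/-- Real points tending to `c` from the right (this is `𝓝[>] c` for finite `c`, and `atBot` for
`c = -∞`). -/
noncomputable def atLeftEnd (c : EReal) : Filter ℝ := comap Real.toEReal (𝓝[>] c)

/-- Real points tending to `d` from the left (this is `𝓝[<] d` for finite `d`, and `atTop` for
`d = ∞`). -/
noncomputable def atRightEnd (d : EReal) : Filter ℝ := comap Real.toEReal (𝓝[<] d)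

/-- Local absolute continuity on a set: absolute continuity on each compact interval inside it. -/
def LocallyACOn (f : ℝ → ℂ) (U : Set ℝ) : Prop :=
  ∀ c d : ℝ, c ≤ d → Set.Icc c d ⊆ U → AbsolutelyContinuousOnInterval f c d

/-- The parabolic factor `P_α`. -/
def parabolicMatrix (α : ℝ) : Matrix (Fin 2) (Fin 2) ℝ := !![1, α; 0, 1]

/-- The hyperbolic factor `H_r`. -/
noncomputable def hyperbolicMatrix (r : ℝ) : Matrix (Fin 2) (Fin 2) ℝ := !![r, 0; 0, 1 / r]

/-- The elliptic factor `E_θ`. -/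
noncomputable def ellipticMatrix (θ : ℝ) : Matrix (Fin 2) (Fin 2) ℝ :=
  !![Real.cos θ, -Real.sin θ; Real.sin θ, Real.cos θ]

/-- The matrix `A_{α,r,θ} = P_α H_r E_θ`. -/
noncomputable def interactionMatrix (α r θ : ℝ) : Matrix (Fin 2) (Fin 2) ℝ :=
  parabolicMatrix α * hyperbolicMatrix r * ellipticMatrix θ

/-- The one-sided limits of `f` and `f'` at `p` exist and
`(f(p+), f'(p+))ᵀ = A (f(p-), f'(p-))ᵀ`. -/
def SatisfiesInterface (A : Matrix (Fin 2) (Fin 2) ℝ) (p : ℝ) (f : ℝ → ℂ) : Prop :=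
  ∃ l r : Fin 2 → ℂ,
    Tendsto f (𝓝[<] p) (𝓝 (l 0)) ∧ Tendsto (deriv f) (𝓝[<] p) (𝓝 (l 1)) ∧
    Tendsto f (𝓝[>] p) (𝓝 (r 0)) ∧ Tendsto (deriv f) (𝓝[>] p) (𝓝 (r 1)) ∧
    r = (A.map (fun s : ℝ => (s : ℂ))).mulVec l

/-- The Lagrange bracket `[f,g]_t`, formed with the right limits at `t`. -/
noncomputable def lagrangeBracket (f g : ℝ → ℂ) (t : ℝ) : ℂ :=
  (starRingEnd ℂ) (Function.rightLim f t) * Function.rightLim (deriv g) t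
    - (starRingEnd ℂ) (Function.rightLim (deriv f) t) * Function.rightLim g t

/-- The deterministic data: an interval `(a,b)` with `-∞ ≤ a < b ≤ ∞`, a real potential
`V ∈ L¹_loc(a,b)`, and points `x n`, `n ∈ I ⊆ ℤ`, of `(a,b)` that accumulate at most at `a`
or `b`. -/
structure PointInteractionData where
  a : EReal
  b : EReal
  a_lt_b : a < b
  V : ℝ → ℝ
  V_locallyIntegrable : LocallyIntegrableOn V (eIoo a b)
  I : Set ℤ
  x : I → ℝ
  x_mem : ∀ n, x n ∈ eIoo a b
  x_injective : Function.Injective x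
  x_discrete : ∀ t ∈ eIoo a b, ¬ AccPt t (𝓟 (Set.range x))

namespace PointInteractionData

variable (S : PointInteractionData)

/-- The set `M` of interaction points. -/
def M : Set ℝ := Set.range S.x

/-- The differential expression `τ f = -f'' + V f`. -/
noncomputable def tau (f : ℝ → ℂ) : ℝ → ℂ := fun t => -deriv (deriv f) t + (S.V t : ℂ) * f t

/-- `f` and `f'` are absolutely continuous in `(c,d) \ M`. -/
def IsRegularOn (c d : EReal) (f : ℝ → ℂ) : Prop :=
  (∀ t ∈ eIoo c d \ S.M, DifferentiableAt ℝ f t) ∧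
    LocallyACOn f (eIoo c d \ S.M) ∧ LocallyACOn (deriv f) (eIoo c d \ S.M)

/-- The interface conditions at all the points of `M` in `(c,d)`. -/
def SatisfiesInterfaces (Λ R Θ : S.I → ℝ) (c d : EReal) (f : ℝ → ℂ) : Prop :=
  ∀ n : S.I, S.x n ∈ eIoo c d →
    SatisfiesInterface (interactionMatrix (Λ n) (R n) (Θ n)) (S.x n) f

/-- `f` is a solution of `(τ_{Λ,R,Θ} - z) f = 0` on `(c,d)`. -/
def IsSolutionOn (Λ R Θ : S.I → ℝ) (z : ℂ) (c d : EReal) (f : ℝ → ℂ) : Prop :=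
  S.IsRegularOn c d f ∧
    (∀ᵐ t ∂(volume.restrict (eIoo c d)), S.tau f t - z * f t = 0) ∧
    S.SatisfiesInterfaces Λ R Θ c d f

/-- `f` is square integrable in a neighbourhood of the left endpoint `a`. -/
def LiesLeft (f : ℝ → ℂ) : Prop :=
  ∃ c ∈ eIoo S.a S.b, MemLp f 2 (volume.restrict (eIoo S.a c))

/-- `f` is square integrable in a neighbourhood of the right endpoint `b`. -/
def LiesRight (f : ℝ → ℂ) : Prop :=
  ∃ c ∈ eIoo S.a S.b, MemLp f 2 (volume.restrict (eIoo c S.b))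

def LimitCircleLeft (Λ R Θ : S.I → ℝ) : Prop :=
  ∀ (z : ℂ) (f : ℝ → ℂ), S.IsSolutionOn Λ R Θ z S.a S.b f → S.LiesLeft f

def LimitCircleRight (Λ R Θ : S.I → ℝ) : Prop :=
  ∀ (z : ℂ) (f : ℝ → ℂ), S.IsSolutionOn Λ R Θ z S.a S.b f → S.LiesRight f

def LimitPointLeft (Λ R Θ : S.I → ℝ) : Prop :=
  ∀ z : ℂ, ∃ f : ℝ → ℂ, S.IsSolutionOn Λ R Θ z S.a S.b f ∧ ¬ S.LiesLeft f

def LimitPointRight (Λ R Θ : S.I → ℝ) : Prop :=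
  ∀ z : ℂ, ∃ f : ℝ → ℂ, S.IsSolutionOn Λ R Θ z S.a S.b f ∧ ¬ S.LiesRight f

/-- Regularity at `a`: `a` is finite, `V ∈ L¹_loc[a,b)`, and `a` is not an accumulation point
of `M`. -/
def RegularLeft : Prop :=
  ∃ a₀ : ℝ, S.a = a₀ ∧ LocallyIntegrableOn S.V (insert a₀ (eIoo S.a S.b)) ∧ ¬ AccPt a₀ (𝓟 S.M)

/-- Regularity at `b`: `b` is finite, `V ∈ L¹_loc(a,b]`, and `b` is not an accumulation point
of `M`. -/
def RegularRight : Prop :=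
  ∃ b₀ : ℝ, S.b = b₀ ∧ LocallyIntegrableOn S.V (insert b₀ (eIoo S.a S.b)) ∧ ¬ AccPt b₀ (𝓟 S.M)

/-- `v` is a non-trivial real solution of `(τ_{Λ,R,Θ} - l) v = 0` near `a`, for some real `l`.
(The values of `v` at the points of `M` carry no information.) -/
def IsBoundarySolutionLeft (Λ R Θ : S.I → ℝ) (v : ℝ → ℝ) : Prop :=
  (∃ l : ℝ, ∃ c ∈ eIoo S.a S.b, S.IsSolutionOn Λ R Θ l S.a c (fun t => (v t : ℂ))) ∧
    ∃ᶠ t in atLeftEnd S.a, t ∉ S.M ∧ v t ≠ 0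

/-- `w` is a non-trivial real solution of `(τ_{Λ,R,Θ} - l) w = 0` near `b`, for some real `l`. -/
def IsBoundarySolutionRight (Λ R Θ : S.I → ℝ) (w : ℝ → ℝ) : Prop :=
  (∃ l : ℝ, ∃ c ∈ eIoo S.a S.b, S.IsSolutionOn Λ R Θ l c S.b (fun t => (w t : ℂ))) ∧
    ∃ᶠ t in atRightEnd S.b, t ∉ S.M ∧ w t ≠ 0

/-- The domain of the maximal operator `T_{Λ,R,Θ}`, described by representatives. -/
def maximalDomain (Λ R Θ : S.I → ℝ) : Set (ℝ → ℂ) :=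
  {f | MemLp f 2 (volume.restrict (eIoo S.a S.b)) ∧
    S.IsRegularOn S.a S.b f ∧
    MemLp (S.tau f) 2 (volume.restrict (eIoo S.a S.b)) ∧
    S.SatisfiesInterfaces Λ R Θ S.a S.b f}

/-- The domain of the restriction `H_{Λ,R,Θ}` of the maximal operator: the functions `f` with
`[v,f]_a = 0` in the limit circle case at `a`, and `[w,f]_b = 0` in the limit circle case
at `b`. -/
def operatorDomain (v w : ℝ → ℝ) (Λ R Θ : S.I → ℝ) : Set (ℝ → ℂ) :=
  {f | f ∈ S.maximalDomain Λ R Θ ∧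
    (S.LimitCircleLeft Λ R Θ →
      Tendsto (lagrangeBracket (fun t => (v t : ℂ)) f) (atLeftEnd S.a) (𝓝 0)) ∧
    (S.LimitCircleRight Λ R Θ →
      Tendsto (lagrangeBracket (fun t => (w t : ℂ)) f) (atRightEnd S.b) (𝓝 0))}

/-- The real eigenvalues of the operator `H_{Λ,R,Θ} f = τ f` in `L²(a,b)`. -/
def pointSpectrum (v w : ℝ → ℝ) (Λ R Θ : S.I → ℝ) : Set ℝ :=
  {E | ∃ u ∈ S.operatorDomain v w Λ R Θ,
    ¬ (u =ᵐ[volume.restrict (eIoo S.a S.b)] 0) ∧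
    S.tau u =ᵐ[volume.restrict (eIoo S.a S.b)] fun t => (E : ℂ) * u t}

/-- The set `P_{R,Θ}(E)` of the `Λ` for which `E` is an eigenvalue of `H_Λ`. -/
def eigenvalueSet (v w : ℝ → ℝ) (R Θ : S.I → ℝ) (E : ℝ) : Set (S.I → ℝ) :=
  {Λ | E ∈ S.pointSpectrum v w Λ R Θ}

end PointInteractionData

/-! Suppose `B` has positive measure. Since each `p n` is continuous and `I` is countable, Fubini
gives one `Λ ∈ B` such that for every `n` some element of `B` differs from `Λ` in the `n`-th
coordinate only (`exists_forall_update_mem`). Let `u` be an eigenfunction for `Λ` and `u'` one for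
the modified parameter.

Both functions solve the same equation on either side of `x n`. On each side the endpoint leaves at
most one solution up to a factor: in the regular case through the boundary condition, in the limit
point case through square integrability. Hence the data of `u` and `u'` are proportional at `x n -`
and at `x n +` (`symplecticForm_eq_zero_left`, `symplecticForm_eq_zero_right`). The two interaction
matrices differ by a parabolic factor `P_s` with `s ≠ 0`, and the only line preserved by such a
shear is the one with vanishing second component. So the derivative of `u` vanishes at `x n +`
(`jet_snd_eq_zero`).

This holds for every `n` with the same `u`. A vector with zero second component is fixed by every
shear, so `u` satisfies the interface conditions for all parameters
(`SatisfiesInterface.of_jet_snd_eq_zero`), and `E` is an eigenvalue for all of them.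

Proportionality is expressed throughout by the vanishing of the symplectic form of the right-limit
data. It is constant along solutions, because Wronskians are constant and interaction matrices have
determinant one. No solution has to be constructed: the a priori bound `norm_le_two_mul` gives
unique continuation and the behaviour at regular endpoints. -/

/-! ### Carathéodory solutions away from the interaction points -/

theorem AbsolutelyContinuousOnInterval.of_dist_le {X Y : Type*} [PseudoMetricSpace X]
    [PseudoMetricSpace Y] {f : ℝ → X} {g : ℝ → Y} {a b : ℝ}
    (hf : AbsolutelyContinuousOnInterval f a b) (h : ∀ s t, dist (g s) (g t) ≤ dist (f s) (f t)) :
    AbsolutelyContinuousOnInterval g a b := by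
  rw [absolutelyContinuousOnInterval_iff] at hf ⊢
  intro ε hε
  obtain ⟨δ, hδ, H⟩ := hf ε hε
  exact ⟨δ, hδ, fun P hP hP' =>
    (Finset.sum_le_sum fun i _ => h _ _).trans_lt (H P hP hP')⟩

/-- Composing with a real functional reduces to the fundamental theorem of calculus for real
absolutely continuous functions. It is used for the real and the imaginary part, whence the factor 2
in `norm_sub_le_two_mul`. -/
theorem AbsolutelyContinuousOnInterval.abs_clm_sub_le {g : ℝ → ℂ} {k : ℝ → ℝ} {s t : ℝ}
    (hst : s ≤ t) (hg : AbsolutelyContinuousOnInterval g s t) (L : ℂ →L[ℝ] ℝ)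
    (hL : ∀ z, |L z| ≤ ‖z‖) (hk : IntervalIntegrable k volume s t)
    (hgk : ∀ᵐ x, x ∈ Set.Icc s t → ‖deriv g x‖ ≤ k x) :
    |L (g t) - L (g s)| ≤ ∫ x in s..t, k x := by
  have hLg : AbsolutelyContinuousOnInterval (fun x => L (g x)) s t := by
    refine hg.of_dist_le fun x y => ?_
    rw [Real.dist_eq, dist_eq_norm, ← map_sub]
    exact hL _
  rw [← hLg.integral_deriv_eq_sub, ← Real.norm_eq_abs]
  refine intervalIntegral.norm_integral_le_of_norm_le hst ?_ hk
  filter_upwards [hg.boundedVariationOn.ae_differentiableAt_of_mem_uIcc, hgk] with x hx hxk hxm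
  have hx' := Set.Ioc_subset_Icc_self hxm
  have hd := (hx (by rwa [Set.uIcc_of_le hst])).hasDerivAt
  have : HasDerivAt (fun x => L (g x)) (L (deriv g x)) x :=
    L.hasFDerivAt.comp_hasDerivAt x hd
  rw [this.deriv]
  exact (hL _).trans (hxk hx')

theorem AbsolutelyContinuousOnInterval.norm_sub_le_two_mul {g : ℝ → ℂ} {k : ℝ → ℝ} {s t : ℝ}
    (hst : s ≤ t) (hg : AbsolutelyContinuousOnInterval g s t)
    (hk : IntervalIntegrable k volume s t)
    (hgk : ∀ᵐ x, x ∈ Set.Icc s t → ‖deriv g x‖ ≤ k x) :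
    ‖g t - g s‖ ≤ 2 * ∫ x in s..t, k x := by
  have h1 := hg.abs_clm_sub_le hst Complex.reCLM (fun z => Complex.abs_re_le_norm z) hk hgk
  have h2 := hg.abs_clm_sub_le hst Complex.imCLM (fun z => Complex.abs_im_le_norm z) hk hgk
  have h3 := Complex.norm_le_abs_re_add_abs_im (g t - g s)
  simp only [Complex.reCLM_apply, Complex.imCLM_apply] at h1 h2
  rw [Complex.sub_re, Complex.sub_im] at h3
  linarith

/-- `f` is a classical (Carathéodory) solution of `f'' = q f` on a set. -/
structure IsClassicalSolution (q : ℝ → ℂ) (U : Set ℝ) (f : ℝ → ℂ) : Prop where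
  differentiableAt : ∀ t ∈ U, DifferentiableAt ℝ f t
  ac : LocallyACOn f U
  ac_deriv : LocallyACOn (deriv f) U
  ae_eq : ∀ᵐ t, t ∈ U → deriv (deriv f) t = q t * f t

namespace IsClassicalSolution

variable {q : ℝ → ℂ} {U U' : Set ℝ} {f g : ℝ → ℂ}

theorem mono (hf : IsClassicalSolution q U f) (h : U' ⊆ U) : IsClassicalSolution q U' f where
  differentiableAt t ht := hf.differentiableAt t (h ht)
  ac c d hcd hs := hf.ac c d hcd (hs.trans h)
  ac_deriv c d hcd hs := hf.ac_deriv c d hcd (hs.trans h)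
  ae_eq := by filter_upwards [hf.ae_eq] with t ht htU using ht (h htU)

theorem continuousAt_deriv (hf : IsClassicalSolution q U f) {t : ℝ} (hU : U ∈ 𝓝 t) :
    ContinuousAt (deriv f) t := by
  obtain ⟨ε, hε, h⟩ := Metric.nhds_basis_closedBall.mem_iff.1 hU
  rw [Real.closedBall_eq_Icc] at h
  have hac := (hf.ac_deriv _ _ (by linarith) h).continuousOn
  rw [Set.uIcc_of_le (by linarith)] at hac
  exact hac.continuousAt (Icc_mem_nhds (by linarith) (by linarith))

/-- The Wronskian of two classical solutions is constant on every interval. -/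
theorem wronskian_eq (hf : IsClassicalSolution q U f) (hg : IsClassicalSolution q U g)
    [hU : U.OrdConnected] {s t : ℝ} (hs : s ∈ U) (ht : t ∈ U) :
    f s * deriv g s - deriv f s * g s = f t * deriv g t - deriv f t * g t := by
  wlog hst : s ≤ t generalizing s t
  · exact (this ht hs (le_of_not_ge hst)).symm
  have hsub : Set.Icc s t ⊆ U := hU.out hs ht
  have e : Set.uIcc s t = Set.Icc s t := Set.uIcc_of_le hst
  have hac : AbsolutelyContinuousOnInterval
      (fun x => f x • deriv g x - deriv f x • g x) s t :=
    ((hf.ac _ _ hst hsub).fun_smul (hg.ac_deriv _ _ hst hsub)).sub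
      ((hf.ac_deriv _ _ hst hsub).fun_smul (hg.ac _ _ hst hsub))
  obtain ⟨C, hC⟩ := hac.const_of_ae_hasDerivAt_zero (by
    filter_upwards [hf.ae_eq, hg.ae_eq,
      (hf.ac_deriv _ _ hst hsub).boundedVariationOn.ae_differentiableAt_of_mem_uIcc,
      (hg.ac_deriv _ _ hst hsub).boundedVariationOn.ae_differentiableAt_of_mem_uIcc]
      with x h1 h2 h3 h4 hx
    have hxU := hsub (e ▸ hx)
    have := ((hf.differentiableAt x hxU).hasDerivAt.mul (h4 hx).hasDerivAt).sub
      ((h3 hx).hasDerivAt.mul (hg.differentiableAt x hxU).hasDerivAt)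
    convert! this using 1
    rw [h1 hxU, h2 hxU]; ring)
  have hCs := hC s (by simp)
  have hCt := hC t (by simp)
  simp only [smul_eq_mul] at hCs hCt
  rw [hCs, hCt]

/-- A priori bound on intervals that are short with respect to the potential. -/
theorem norm_le_two_mul {a b : ℝ} (hf : IsClassicalSolution q (Set.Ioo a b) f)
    (hq : IntegrableOn q (Set.Ioo a b)) (hab : b - a ≤ 1 / 2)
    (hsmall : ∫ x in Set.Ioo a b, ‖q x‖ ≤ 1 / 4)
    {s t : ℝ} (hs : s ∈ Set.Ioo a b) (ht : t ∈ Set.Ioo a b) :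
    ‖(f t, deriv f t)‖ ≤ 2 * ‖(f s, deriv f s)‖ := by
  have hsub : Set.uIcc s t ⊆ Set.Ioo a b := Set.OrdConnected.uIcc_subset inferInstance hs ht
  have hcont : ContinuousOn (fun x => ‖(f x, deriv f x)‖) (Set.uIcc s t) := by
    intro x hx
    have hn : Set.Ioo a b ∈ 𝓝 x := isOpen_Ioo.mem_nhds (hsub hx)
    exact ((hf.differentiableAt x (hsub hx)).continuousAt.prodMk
      (hf.continuousAt_deriv hn)).norm.continuousWithinAt
  -- A maximum point replaces Gronwall's inequality. It is sought between `s` and `t`, so nothing is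
  -- needed at the ends `a` and `b`.
  obtain ⟨m, hm, hmax⟩ := isCompact_uIcc.exists_isMaxOn Set.nonempty_uIcc hcont
  set C := ‖(f m, deriv f m)‖ with hC
  have hle : ∀ x ∈ Set.uIcc s t, ‖(f x, deriv f x)‖ ≤ C := fun x hx => hmax hx
  have hC0 : 0 ≤ C := norm_nonneg _
  have hsm : Set.uIcc s m ⊆ Set.uIcc s t := Set.uIcc_subset_uIcc_left hm
  have hsm' : Set.uIcc s m ⊆ Set.Ioo a b := hsm.trans hsub
  have hmm := hsub hm
  have hf0 : ‖f m - f s‖ ≤ C * ‖m - s‖ := by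
    refine Convex.norm_image_sub_le_of_norm_deriv_le (s := Set.uIcc s m)
      (fun x hx => hf.differentiableAt x (hsm' hx))
      (fun x hx => ?_) (convex_uIcc s m) (by simp) (by simp)
    exact (norm_snd_le (f x, deriv f x)).trans (hle x (hsm hx))
  have hlen : ‖m - s‖ ≤ 1 / 2 := by
    rw [Real.norm_eq_abs, abs_le]
    constructor <;> linarith [hs.1, hs.2, hmm.1, hmm.2]
  have key : ∀ x y : ℝ, x ≤ y → Set.Icc x y ⊆ Set.uIcc s t →
      ‖deriv f y - deriv f x‖ ≤ 2 * (C * (1 / 4)) := by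
    intro x y hxy hxy'
    have hk : IntegrableOn (fun u => C * ‖q u‖) (Set.Ioo a b) := hq.norm.const_mul C
    have hk' : IntervalIntegrable (fun u => C * ‖q u‖) volume x y := by
      rw [intervalIntegrable_iff_integrableOn_Icc_of_le hxy]
      exact hk.mono_set (hxy'.trans hsub)
    have h1 := (hf.ac_deriv x y hxy (hxy'.trans hsub)).norm_sub_le_two_mul hxy hk' (by
      filter_upwards [hf.ae_eq] with u hu hum
      rw [hu (hsub (hxy' hum)), norm_mul, mul_comm]
      gcongr
      exact (norm_fst_le (f u, deriv f u)).trans (hle u (hxy' hum)))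
    refine h1.trans ?_
    gcongr
    rw [intervalIntegral.integral_of_le hxy]
    calc ∫ u in Set.Ioc x y, C * ‖q u‖ ≤ ∫ u in Set.Ioo a b, C * ‖q u‖ := by
          refine setIntegral_mono_set hk (ae_of_all _ fun u => by positivity) ?_
          exact (Set.Ioc_subset_Icc_self.trans (hxy'.trans hsub)).eventuallyLE
      _ = C * ∫ u in Set.Ioo a b, ‖q u‖ := integral_const_mul _ _
      _ ≤ C * (1 / 4) := by gcongr
  have hf1 : ‖deriv f m - deriv f s‖ ≤ 2 * (C * (1 / 4)) := by
    rcases le_total s m with h | h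
    · exact key s m h (by rwa [Set.uIcc_of_le h] at hsm)
    · rw [norm_sub_rev]
      exact key m s h (by rwa [Set.uIcc_of_ge h] at hsm)
  -- From `s` to `m` either component changes by at most `C / 2`: `f` because the interval is short,
  -- `deriv f` because `2 * (C * (1 / 4)) = C / 2`.
  have h2 : C ≤ ‖(f s, deriv f s)‖ + C / 2 := by
    refine hC.le.trans ((Prod.norm_mk _ _).le.trans (max_le ?_ ?_))
    · have := norm_le_norm_add_norm_sub' (f m) (f s)
      have h3 : C * ‖m - s‖ ≤ C * (1 / 2) := by gcongr
      linarith [norm_fst_le (f s, deriv f s)]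
    · have := norm_le_norm_add_norm_sub' (deriv f m) (deriv f s)
      linarith [norm_snd_le (f s, deriv f s)]
  linarith [hle t (by simp)]

end IsClassicalSolution

/-- The integral of an integrable function over short intervals is small. -/
theorem MeasureTheory.IntegrableOn.exists_forall_setIntegral_Ioo_le {q : ℝ → ℂ} {U : Set ℝ}
    (hq : IntegrableOn q U) {ε : ℝ} (hε : 0 < ε) :
    ∃ δ > 0, ∀ a b : ℝ, Set.Ioo a b ⊆ U → b - a < δ →
      ∫ x in Set.Ioo a b, ‖q x‖ ≤ ε := by
  obtain ⟨δ, hδ, H⟩ := exists_pos_setLIntegral_lt_of_measure_lt (μ := volume.restrict U)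
    (f := fun x => ‖q x‖ₑ) hq.hasFiniteIntegral.ne
    (ENNReal.ofReal_pos.2 hε).ne'
  obtain ⟨δ', hδ', hlt⟩ : ∃ δ' : ℝ, 0 < δ' ∧ ENNReal.ofReal δ' < δ := by
    obtain ⟨r, hr, hr'⟩ := ENNReal.lt_iff_exists_nnreal_btwn.1 hδ
    exact ⟨r, by exact_mod_cast hr, by simpa using hr'⟩
  refine ⟨δ', hδ', fun a b hU hab => ?_⟩
  have h1 := H (Set.Ioo a b) (by
    refine (Measure.restrict_apply_le _ _).trans_lt ?_
    rw [Real.volume_Ioo]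
    exact (ENNReal.ofReal_le_ofReal hab.le).trans_lt hlt)
  rw [Measure.restrict_restrict measurableSet_Ioo, Set.inter_eq_left.2 hU] at h1
  rw [integral_norm_eq_lintegral_enorm (hq.mono_set hU).aestronglyMeasurable]
  exact ENNReal.toReal_le_of_le_ofReal hε.le h1.le

/-! ### Extended intervals, jets and the symplectic form -/

theorem isOpen_eIoo (c d : EReal) : IsOpen (eIoo c d) :=
  (isOpen_Ioo (a := c) (b := d)).preimage continuous_coe_real_ereal

theorem ordConnected_eIoo (c d : EReal) : (eIoo c d).OrdConnected :=
  ⟨fun _ hs _ ht _ hx => ⟨hs.1.trans_le (EReal.coe_le_coe_iff.2 hx.1),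
    (EReal.coe_le_coe_iff.2 hx.2).trans_lt ht.2⟩⟩

theorem measurableSet_eIoo (c d : EReal) : MeasurableSet (eIoo c d) :=
  (isOpen_eIoo c d).measurableSet

theorem eIoo_subset_eIoo {c d c' d' : EReal} (hc : c' ≤ c) (hd : d ≤ d') :
    eIoo c d ⊆ eIoo c' d' :=
  fun _ ht => ⟨hc.trans_lt ht.1, ht.2.trans_le hd⟩

/-- The right limits of a function and of its derivative. -/
noncomputable def jet (f : ℝ → ℂ) (t : ℝ) : ℂ × ℂ :=
  (Function.rightLim f t, Function.rightLim (deriv f) t)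

/-- The symplectic form on `ℂ²`. -/
def symplecticForm (y z : ℂ × ℂ) : ℂ := y.1 * z.2 - y.2 * z.1

/-- The action of a real matrix on `ℂ²`. -/
def matrixAct (A : Matrix (Fin 2) (Fin 2) ℝ) (y : ℂ × ℂ) : ℂ × ℂ :=
  (A 0 0 * y.1 + A 0 1 * y.2, A 1 0 * y.1 + A 1 1 * y.2)

theorem symplecticForm_matrixAct (A : Matrix (Fin 2) (Fin 2) ℝ) (y z : ℂ × ℂ) :
    symplecticForm (matrixAct A y) (matrixAct A z) = (A.det : ℂ) * symplecticForm y z := by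
  simp only [symplecticForm, matrixAct, Matrix.det_fin_two]
  push_cast
  ring

theorem matrixAct_eq_zero_iff {A : Matrix (Fin 2) (Fin 2) ℝ} (hA : A.det = 1) {y : ℂ × ℂ} :
    matrixAct A y = 0 ↔ y = 0 := by
  constructor
  · intro h
    have hA' : (A 0 0 : ℂ) * A 1 1 - A 0 1 * A 1 0 = 1 := by
      rw [Matrix.det_fin_two] at hA
      exact_mod_cast hA
    obtain ⟨h0, h1⟩ := Prod.ext_iff.1 h
    simp only [matrixAct, Prod.fst_zero, Prod.snd_zero] at h0 h1
    ext
    · simp only [Prod.fst_zero]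
      linear_combination (A 1 1 : ℂ) * h0 - (A 0 1 : ℂ) * h1 - y.1 * hA'
    · simp only [Prod.snd_zero]
      linear_combination (A 0 0 : ℂ) * h1 - (A 1 0 : ℂ) * h0 - y.2 * hA'
  · rintro rfl
    simp [matrixAct]

theorem Filter.Tendsto.symplecticForm {X : Type*} {l : Filter X} {f g : X → ℂ × ℂ} {y z : ℂ × ℂ}
    (hf : Tendsto f l (𝓝 y)) (hg : Tendsto g l (𝓝 z)) :
    Tendsto (fun x => symplecticForm (f x) (g x)) l (𝓝 (symplecticForm y z)) :=
  (hf.fst_nhds.mul hg.snd_nhds).sub (hf.snd_nhds.mul hg.fst_nhds)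

theorem det_interactionMatrix (α θ : ℝ) {r : ℝ} (hr : 0 < r) :
    (interactionMatrix α r θ).det = 1 := by
  have h : r * r⁻¹ = 1 := mul_inv_cancel₀ hr.ne'
  have h' : (ellipticMatrix θ).det = 1 := by
    rw [ellipticMatrix, Matrix.det_fin_two_of]
    linear_combination Real.cos_sq_add_sin_sq θ
  rw [interactionMatrix, Matrix.det_mul, Matrix.det_mul, h']
  simp [parabolicMatrix, hyperbolicMatrix, Matrix.det_fin_two_of, h]

theorem jet_eq_of_continuousAt {f : ℝ → ℂ} {t : ℝ} (hf : ContinuousAt f t)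
    (hf' : ContinuousAt (deriv f) t) : jet f t = (f t, deriv f t) := by
  rw [jet, hf.continuousWithinAt.rightLim_eq, hf'.continuousWithinAt.rightLim_eq]

theorem SatisfiesInterface.exists_tendsto {A : Matrix (Fin 2) (Fin 2) ℝ} {t : ℝ} {f : ℝ → ℂ}
    (h : SatisfiesInterface A t f) :
    ∃ l : ℂ × ℂ, Tendsto (fun s => (f s, deriv f s)) (𝓝[<] t) (𝓝 l) ∧
      Tendsto (fun s => (f s, deriv f s)) (𝓝[>] t) (𝓝 (jet f t)) ∧
      jet f t = matrixAct A l := by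
  obtain ⟨l, r, h1, h2, h3, h4, rfl⟩ := h
  have e : jet f t = (_, _) :=
    Prod.ext (rightLim_eq_of_tendsto h3) (rightLim_eq_of_tendsto h4)
  refine ⟨(l 0, l 1), h1.prodMk_nhds h2, ?_, ?_⟩
  · rw [e]
    exact h3.prodMk_nhds h4
  · rw [e]
    simp [matrixAct]

/-- This lets points outside `M` be treated as interaction points with trivial matrix, which avoids
a case distinction in the local arguments. -/
theorem satisfiesInterface_one {t : ℝ} {f : ℝ → ℂ} (hf : ContinuousAt f t)
    (hf' : ContinuousAt (deriv f) t) : SatisfiesInterface 1 t f := by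
  refine ⟨![f t, deriv f t], ![f t, deriv f t], hf.tendsto.mono_left nhdsWithin_le_nhds,
    hf'.tendsto.mono_left nhdsWithin_le_nhds, hf.tendsto.mono_left nhdsWithin_le_nhds,
    hf'.tendsto.mono_left nhdsWithin_le_nhds, ?_⟩
  simp

/-! ### Solutions across interaction points: constancy of the form, unique continuation -/

namespace PointInteractionData

variable {S : PointInteractionData}

theorem eventually_notMem_M {t : ℝ} (ht : ¬ AccPt t (𝓟 S.M)) : ∀ᶠ s in 𝓝[≠] t, s ∉ S.M := by
  rw [accPt_iff_frequently_nhdsNE] at ht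
  simpa using ht

theorem compl_M_mem_nhds {t : ℝ} (ht : t ∈ eIoo S.a S.b) (htM : t ∉ S.M) : S.Mᶜ ∈ 𝓝 t := by
  have := eventually_notMem_M (S.x_discrete t ht)
  rw [eventually_nhdsWithin_iff] at this
  filter_upwards [this] with s hs
  by_cases h : s = t
  · exact h ▸ htM
  · exact hs h

theorem countable_M : S.M.Countable := Set.countable_range _

/-- The coefficient of the equation `f'' = (V - z) f`. -/
noncomputable def shiftedPotential (S : PointInteractionData) (z : ℂ) (t : ℝ) : ℂ := S.V t - z

theorem integrableOn_shiftedPotential {U : Set ℝ} (hV : IntegrableOn S.V U)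
    (hU : volume U ≠ ⊤) (z : ℂ) : IntegrableOn (S.shiftedPotential z) U :=
  hV.ofReal.sub (integrableOn_const hU)

namespace IsSolutionOn

variable {Λ Λ' R Θ : S.I → ℝ} {z : ℂ} {c d c' d' : EReal} {f g : ℝ → ℂ}

theorem mono (hf : S.IsSolutionOn Λ R Θ z c d f) (hsub : eIoo c' d' ⊆ eIoo c d)
    (hΛ : ∀ n, S.x n ∈ eIoo c' d' → Λ n = Λ' n) : S.IsSolutionOn Λ' R Θ z c' d' f := by
  obtain ⟨⟨h1, h2, h3⟩, h4, h5⟩ := hf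
  have hsub' : eIoo c' d' \ S.M ⊆ eIoo c d \ S.M := Set.sdiff_subset_sdiff_left hsub
  refine ⟨⟨fun t ht => h1 t (hsub' ht), fun p q hpq h => h2 p q hpq (h.trans hsub'),
    fun p q hpq h => h3 p q hpq (h.trans hsub')⟩, ae_restrict_of_ae_restrict_of_subset hsub h4, ?_⟩
  intro n hn
  rw [← hΛ n hn]
  exact h5 n (hsub hn)

theorem isClassicalSolution (hf : S.IsSolutionOn Λ R Θ z c d f) :
    IsClassicalSolution (S.shiftedPotential z) (eIoo c d \ S.M) f where
  differentiableAt := hf.1.1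
  ac := hf.1.2.1
  ac_deriv := hf.1.2.2
  ae_eq := by
    filter_upwards [(ae_restrict_iff' (measurableSet_eIoo c d)).1 hf.2.1] with t ht htU
    have := ht htU.1
    rw [tau] at this
    rw [shiftedPotential]
    linear_combination -this

theorem diff_mem_nhds (hcd : eIoo c d ⊆ eIoo S.a S.b) {t : ℝ} (ht : t ∈ eIoo c d)
    (htM : t ∉ S.M) : eIoo c d \ S.M ∈ 𝓝 t :=
  inter_mem ((isOpen_eIoo c d).mem_nhds ht) (compl_M_mem_nhds (hcd ht) htM)

theorem continuousAt (hf : S.IsSolutionOn Λ R Θ z c d f) {t : ℝ} (ht : t ∈ eIoo c d)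
    (htM : t ∉ S.M) : ContinuousAt f t :=
  (hf.1.1 t ⟨ht, htM⟩).continuousAt

theorem continuousAt_deriv (hf : S.IsSolutionOn Λ R Θ z c d f) (hcd : eIoo c d ⊆ eIoo S.a S.b)
    {t : ℝ} (ht : t ∈ eIoo c d) (htM : t ∉ S.M) : ContinuousAt (deriv f) t :=
  hf.isClassicalSolution.continuousAt_deriv (diff_mem_nhds hcd ht htM)

theorem jet_eq (hf : S.IsSolutionOn Λ R Θ z c d f) (hcd : eIoo c d ⊆ eIoo S.a S.b)
    {t : ℝ} (ht : t ∈ eIoo c d) (htM : t ∉ S.M) : jet f t = (f t, deriv f t) :=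
  jet_eq_of_continuousAt (hf.continuousAt ht htM) (hf.continuousAt_deriv hcd ht htM)

theorem exists_satisfiesInterface (hR : ∀ n, 0 < R n) (hcd : eIoo c d ⊆ eIoo S.a S.b) {t : ℝ}
    (ht : t ∈ eIoo c d) :
    ∃ A : Matrix (Fin 2) (Fin 2) ℝ, A.det = 1 ∧
      ∀ f, S.IsSolutionOn Λ R Θ z c d f → SatisfiesInterface A t f := by
  by_cases htM : t ∈ S.M
  · obtain ⟨n, rfl⟩ := htM
    exact ⟨_, det_interactionMatrix (Λ n) (Θ n) (hR n), fun f hf => hf.2.2 n ht⟩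
  · exact ⟨1, Matrix.det_one, fun f hf =>
      satisfiesInterface_one (hf.continuousAt ht htM) (hf.continuousAt_deriv hcd ht htM)⟩

theorem eventually_jet_eq (hf : S.IsSolutionOn Λ R Θ z c d f) (hcd : eIoo c d ⊆ eIoo S.a S.b)
    {t : ℝ} (ht : t ∈ eIoo c d) : ∀ᶠ s in 𝓝[≠] t, (f s, deriv f s) = jet f s := by
  filter_upwards [eventually_notMem_M (S.x_discrete t (hcd ht)),
    nhdsWithin_le_nhds ((isOpen_eIoo c d).mem_nhds ht)] with s hs hs'
  exact (hf.jet_eq hcd hs' hs).symm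

theorem exists_tendsto_jet (hf : S.IsSolutionOn Λ R Θ z c d f) (hcd : eIoo c d ⊆ eIoo S.a S.b)
    {t : ℝ} (ht : t ∈ eIoo c d) {A : Matrix (Fin 2) (Fin 2) ℝ} (h : SatisfiesInterface A t f) :
    ∃ l : ℂ × ℂ, Tendsto (jet f) (𝓝[<] t) (𝓝 l) ∧
      Tendsto (jet f) (𝓝[>] t) (𝓝 (jet f t)) ∧ jet f t = matrixAct A l := by
  obtain ⟨l, h1, h2, h3⟩ := h.exists_tendsto
  have := hf.eventually_jet_eq hcd ht
  refine ⟨l, h1.congr' ?_, h2.congr' ?_, h3⟩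
  · exact this.filter_mono (nhdsWithin_mono _ fun s hs => ne_of_lt hs)
  · exact this.filter_mono (nhdsWithin_mono _ fun s hs => ne_of_gt hs)

/-- On an interval without interaction points the symplectic form of two solutions is constant. -/
theorem symplecticForm_eq_of_disjoint (hf : S.IsSolutionOn Λ R Θ z c d f)
    (hg : S.IsSolutionOn Λ R Θ z c d g) (hcd : eIoo c d ⊆ eIoo S.a S.b) {U : Set ℝ}
    [U.OrdConnected] (hU : U ⊆ eIoo c d \ S.M) {s t : ℝ} (hs : s ∈ U) (ht : t ∈ U) :
    symplecticForm (jet f s) (jet g s) = symplecticForm (jet f t) (jet g t) := by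
  rw [hf.jet_eq hcd (hU hs).1 (hU hs).2, hf.jet_eq hcd (hU ht).1 (hU ht).2,
    hg.jet_eq hcd (hU hs).1 (hU hs).2, hg.jet_eq hcd (hU ht).1 (hU ht).2]
  exact (hf.isClassicalSolution.mono hU).wronskian_eq (hg.isClassicalSolution.mono hU) hs ht

theorem norm_jet_le (hf : S.IsSolutionOn Λ R Θ z c d f) (hcd : eIoo c d ⊆ eIoo S.a S.b) {p q : ℝ}
    (hU : Set.Ioo p q ⊆ eIoo c d \ S.M) (hpq : q - p ≤ 1 / 2)
    (hV : IntegrableOn (S.shiftedPotential z) (Set.Ioo p q))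
    (hsmall : ∫ x in Set.Ioo p q, ‖S.shiftedPotential z x‖ ≤ 1 / 4) {s t : ℝ}
    (hs : s ∈ Set.Ioo p q) (ht : t ∈ Set.Ioo p q) : ‖jet f t‖ ≤ 2 * ‖jet f s‖ := by
  rw [hf.jet_eq hcd (hU hs).1 (hU hs).2, hf.jet_eq hcd (hU ht).1 (hU ht).2]
  exact (hf.isClassicalSolution.mono hU).norm_le_two_mul hV hpq hsmall hs ht

/-- Discreteness of `M` and local integrability of `V` provide a neighbourhood on whose two halves
the a priori bound applies. -/
theorem exists_small_nhds (z : ℂ) (hcd : eIoo c d ⊆ eIoo S.a S.b) {t : ℝ} (ht : t ∈ eIoo c d) :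
    ∃ p q : ℝ, p < t ∧ t < q ∧ Set.Ioo p t ⊆ eIoo c d \ S.M ∧ Set.Ioo t q ⊆ eIoo c d \ S.M ∧
      q - p ≤ 1 / 2 ∧ IntegrableOn (S.shiftedPotential z) (Set.Ioo p q) ∧
      ∫ x in Set.Ioo p q, ‖S.shiftedPotential z x‖ ≤ 1 / 4 := by
  obtain ⟨W, hW, hVW⟩ := S.V_locallyIntegrable t (hcd ht)
  rw [(isOpen_eIoo S.a S.b).nhdsWithin_eq (hcd ht)] at hW
  have hM := eventually_notMem_M (S.x_discrete t (hcd ht))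
  rw [eventually_nhdsWithin_iff] at hM
  obtain ⟨ε, hε, hball⟩ := Metric.mem_nhds_iff.1
    (inter_mem hW (inter_mem hM ((isOpen_eIoo c d).mem_nhds ht)))
  rw [Real.ball_eq_Ioo] at hball
  have hI : IntegrableOn (S.shiftedPotential z) (Set.Ioo (t - ε) (t + ε)) :=
    integrableOn_shiftedPotential (hVW.mono_set fun s hs => (hball hs).1) (by simp) z
  obtain ⟨δ, hδ, hsmall⟩ := hI.exists_forall_setIntegral_Ioo_le (ε := 1 / 4) (by norm_num)
  obtain ⟨η, hη, hη'⟩ : ∃ η : ℝ, 0 < η ∧ η ≤ ε ∧ η ≤ 1 / 4 ∧ η ≤ δ / 3 :=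
    ⟨min ε (min (1 / 4) (δ / 3)), by positivity, min_le_left _ _,
      (min_le_right _ _).trans (min_le_left _ _), (min_le_right _ _).trans (min_le_right _ _)⟩
  have hsub : Set.Ioo (t - η) (t + η) ⊆ Set.Ioo (t - ε) (t + ε) :=
    Set.Ioo_subset_Ioo (by linarith) (by linarith)
  refine ⟨t - η, t + η, by linarith, by linarith, fun s hs => ?_, fun s hs => ?_, by linarith,
    hI.mono_set hsub, hsmall _ _ hsub (by linarith)⟩
  · have := hball (hsub ⟨hs.1, by linarith [hs.2]⟩)
    exact ⟨this.2.2, this.2.1 hs.2.ne⟩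
  · have := hball (hsub ⟨by linarith [hs.1], hs.2⟩)
    exact ⟨this.2.2, this.2.1 hs.1.ne'⟩

/-- On each half of a small neighbourhood the Wronskian is constant, hence equal to its one-sided
limit at `t`; the two limits agree because the interface matrix has determinant one. -/
theorem eventually_symplecticForm_eq (hR : ∀ n, 0 < R n) (hf : S.IsSolutionOn Λ R Θ z c d f)
    (hg : S.IsSolutionOn Λ R Θ z c d g) (hcd : eIoo c d ⊆ eIoo S.a S.b) {t : ℝ}
    (ht : t ∈ eIoo c d) :
    ∀ᶠ s in 𝓝 t, symplecticForm (jet f s) (jet g s) = symplecticForm (jet f t) (jet g t) := by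
  obtain ⟨p, q, hpt, htq, hl, hr, -⟩ := exists_small_nhds z hcd ht
  obtain ⟨A, hdet, hA⟩ := exists_satisfiesInterface (Λ := Λ) (Θ := Θ) (z := z) hR hcd ht
  obtain ⟨lf, hf1, hf2, hf3⟩ := hf.exists_tendsto_jet hcd ht (hA f hf)
  obtain ⟨lg, hg1, hg2, hg3⟩ := hg.exists_tendsto_jet hcd ht (hA g hg)
  filter_upwards [Ioo_mem_nhds hpt htq] with s hs
  rcases lt_trichotomy s t with h | rfl | h
  · have e : symplecticForm (jet f t) (jet g t) = symplecticForm lf lg := by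
      rw [hf3, hg3, symplecticForm_matrixAct, hdet, Complex.ofReal_one, one_mul]
    rw [e]
    refine tendsto_nhds_unique (tendsto_const_nhds.congr' ?_) (hf1.symplecticForm hg1)
    filter_upwards [Ioo_mem_nhdsLT hpt] with s' hs'
    exact hf.symplecticForm_eq_of_disjoint hg hcd hl ⟨hs.1, h⟩ hs'
  · rfl
  · refine tendsto_nhds_unique (tendsto_const_nhds.congr' ?_) (hf2.symplecticForm hg2)
    filter_upwards [Ioo_mem_nhdsGT htq] with s' hs'
    exact hf.symplecticForm_eq_of_disjoint hg hcd hr ⟨h, hs.2⟩ hs'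

/-- The symplectic form of two solutions of the same equation is constant. -/
theorem symplecticForm_eq (hR : ∀ n, 0 < R n) (hf : S.IsSolutionOn Λ R Θ z c d f)
    (hg : S.IsSolutionOn Λ R Θ z c d g) (hcd : eIoo c d ⊆ eIoo S.a S.b) {s t : ℝ}
    (hs : s ∈ eIoo c d) (ht : t ∈ eIoo c d) :
    symplecticForm (jet f s) (jet g s) = symplecticForm (jet f t) (jet g t) := by
  have hconn : IsPreconnected (eIoo c d) := (ordConnected_eIoo c d).isPreconnected
  refine hconn.induction₂'
    (fun s t => symplecticForm (jet f s) (jet g s) = symplecticForm (jet f t) (jet g t))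
    (fun x hx => ?_) (fun _ _ _ _ _ _ => Eq.trans) hs ht
  filter_upwards [nhdsWithin_le_nhds (eventually_symplecticForm_eq hR hf hg hcd hx)] with y hy
  exact ⟨hy.symm, hy⟩

/-- The a priori bound is symmetric in its two points, so it survives passage to the one-sided
limits at `t`; across `t` the matrix is invertible. -/
theorem eventually_jet_eq_zero_iff (hR : ∀ n, 0 < R n) (hf : S.IsSolutionOn Λ R Θ z c d f)
    (hcd : eIoo c d ⊆ eIoo S.a S.b) {t : ℝ} (ht : t ∈ eIoo c d) :
    ∀ᶠ s in 𝓝 t, jet f s = 0 ↔ jet f t = 0 := by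
  obtain ⟨p, q, hpt, htq, hl, hr, hlen, hI, hsmall⟩ := exists_small_nhds z hcd ht
  obtain ⟨A, hdet, hA⟩ := exists_satisfiesInterface (Λ := Λ) (Θ := Θ) (z := z) hR hcd ht
  obtain ⟨l, h1, h2, h3⟩ := hf.exists_tendsto_jet hcd ht (hA f hf)
  have hmono : ∀ {p' q' : ℝ}, Set.Ioo p' q' ⊆ Set.Ioo p q →
      ∫ x in Set.Ioo p' q', ‖S.shiftedPotential z x‖ ≤ 1 / 4 := fun h =>
    (setIntegral_mono_set hI.norm (ae_of_all _ fun _ => norm_nonneg _) h.eventuallyLE).trans hsmall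
  have zero_iff : ∀ {y : ℂ × ℂ} {s : ℝ}, ‖jet f s‖ ≤ 2 * ‖y‖ → ‖y‖ ≤ 2 * ‖jet f s‖ →
      (jet f s = 0 ↔ y = 0) := by
    intro y s ha hb
    constructor <;> intro h
    · rw [h, norm_zero, mul_zero] at hb
      exact norm_le_zero_iff.1 hb
    · rw [h, norm_zero, mul_zero] at ha
      exact norm_le_zero_iff.1 ha
  filter_upwards [Ioo_mem_nhds hpt htq] with s hs
  rcases lt_trichotomy s t with h | rfl | h
  · rw [h3, matrixAct_eq_zero_iff hdet]
    have hsub : Set.Ioo p t ⊆ Set.Ioo p q := Set.Ioo_subset_Ioo_right htq.le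
    have hb := fun s' hs' => hf.norm_jet_le hcd hl (by linarith) (hI.mono_set hsub) (hmono hsub)
      (s := s') (t := s) hs' ⟨hs.1, h⟩
    have hb' := fun s' hs' => hf.norm_jet_le hcd hl (by linarith) (hI.mono_set hsub) (hmono hsub)
      (s := s) (t := s') ⟨hs.1, h⟩ hs'
    refine zero_iff (ge_of_tendsto (h1.norm.const_mul 2) ?_) (le_of_tendsto h1.norm ?_)
    · filter_upwards [Ioo_mem_nhdsLT hpt] with s' hs' using hb s' hs'
    · filter_upwards [Ioo_mem_nhdsLT hpt] with s' hs' using hb' s' hs'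
  · rfl
  · have hsub : Set.Ioo t q ⊆ Set.Ioo p q := Set.Ioo_subset_Ioo_left hpt.le
    have hb := fun s' hs' => hf.norm_jet_le hcd hr (by linarith) (hI.mono_set hsub) (hmono hsub)
      (s := s') (t := s) hs' ⟨h, hs.2⟩
    have hb' := fun s' hs' => hf.norm_jet_le hcd hr (by linarith) (hI.mono_set hsub) (hmono hsub)
      (s := s) (t := s') ⟨h, hs.2⟩ hs'
    refine zero_iff (ge_of_tendsto (h2.norm.const_mul 2) ?_) (le_of_tendsto h2.norm ?_)
    · filter_upwards [Ioo_mem_nhdsGT htq] with s' hs' using hb s' hs'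
    · filter_upwards [Ioo_mem_nhdsGT htq] with s' hs' using hb' s' hs'

/-- Unique continuation: a solution with vanishing data at one point vanishes. -/
theorem jet_eq_zero (hR : ∀ n, 0 < R n) (hf : S.IsSolutionOn Λ R Θ z c d f)
    (hcd : eIoo c d ⊆ eIoo S.a S.b) {s t : ℝ} (hs : s ∈ eIoo c d) (ht : t ∈ eIoo c d)
    (h : jet f s = 0) : jet f t = 0 := by
  have hconn : IsPreconnected (eIoo c d) := (ordConnected_eIoo c d).isPreconnected
  refine (hconn.induction₂' (fun s t => jet f s = 0 ↔ jet f t = 0)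
    (fun x hx => ?_) (fun _ _ _ _ _ _ => Iff.trans) hs ht).1 h
  filter_upwards [nhdsWithin_le_nhds (eventually_jet_eq_zero_iff hR hf hcd hx)] with y hy
  exact ⟨hy.symm, hy⟩

theorem ae_eq_zero (hR : ∀ n, 0 < R n) (hf : S.IsSolutionOn Λ R Θ z c d f)
    (hcd : eIoo c d ⊆ eIoo S.a S.b) {s : ℝ} (hs : s ∈ eIoo c d)
    (h : jet f s = 0) : f =ᵐ[volume.restrict (eIoo c d)] 0 := by
  filter_upwards [ae_restrict_mem (measurableSet_eIoo c d),
    ae_restrict_of_ae ((countable_M (S := S)).ae_notMem volume)] with t ht htM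
  have := hf.jet_eq_zero hR hcd hs ht h
  rw [hf.jet_eq hcd ht htM] at this
  exact congrArg Prod.fst this

end IsSolutionOn

end PointInteractionData

/-! ### Resampling one coordinate of a product measure -/

section InfiniteProduct

variable {ι : Type*} [DecidableEq ι] {X : ι → Type*} [∀ i, MeasurableSpace (X i)]
  (μ : ∀ i, Measure (X i)) [∀ i, IsProbabilityMeasure (μ i)]

/-- Resampling one coordinate preserves the product measure. -/
theorem measurePreserving_update_infinitePi (n : ι) :
    MeasurePreserving (fun y : (∀ i, X i) × X n => Function.update y.1 n y.2)
      ((Measure.infinitePi μ).prod (μ n)) (Measure.infinitePi μ) := by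
  have hm : Measurable fun y : (∀ i, X i) × X n => Function.update y.1 n y.2 := by
    refine measurable_pi_lambda _ fun i => ?_
    by_cases h : i = n
    · subst h
      simpa using measurable_snd
    · simp only [Function.update_of_ne h]
      exact (measurable_pi_apply i).comp measurable_fst
  refine ⟨hm, Measure.eq_infinitePi μ fun s t ht => ?_⟩
  rw [Measure.map_apply hm (MeasurableSet.pi s.countable_toSet fun i _ => ht i)]
  by_cases hn : n ∈ s
  · have : (fun y : (∀ i, X i) × X n => Function.update y.1 n y.2) ⁻¹' (Set.pi s t)
        = (Set.pi (s.erase n) t) ×ˢ (t n) := by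
      ext y
      simp only [Set.mem_preimage, Set.mem_pi, Set.mem_prod, Finset.mem_coe, Finset.mem_erase]
      constructor
      · intro h
        refine ⟨fun i hi => ?_, by simpa using h n hn⟩
        simpa [Function.update_of_ne hi.1] using h i hi.2
      · rintro ⟨h1, h2⟩ i hi
        by_cases h : i = n
        · subst h
          simpa using h2
        · simpa [Function.update_of_ne h] using h1 i ⟨h, hi⟩
    rw [this, Measure.prod_prod, Measure.infinitePi_pi _ fun i _ => ht i,
      Finset.prod_erase_mul _ _ hn]
  · have : (fun y : (∀ i, X i) × X n => Function.update y.1 n y.2) ⁻¹' (Set.pi s t)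
        = (Set.pi s t) ×ˢ Set.univ := by
      ext y
      simp only [Set.mem_preimage, Set.mem_pi, Set.mem_prod, Finset.mem_coe, Set.mem_univ,
        and_true]
      refine forall₂_congr fun i hi => ?_
      have h : i ≠ n := fun h => hn (h ▸ hi)
      rw [Function.update_of_ne h]
    rw [this, Measure.prod_prod, Measure.infinitePi_pi _ fun i _ => ht i, measure_univ, mul_one]

/-- Almost every point of a measurable set lies on a line parallel to the `n`-th axis that meets
the set in positive measure. -/
theorem ae_measure_update_ne_zero (n : ι) {B : Set (∀ i, X i)} (hB : MeasurableSet B) :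
    ∀ᵐ x ∂Measure.infinitePi μ, x ∈ B → μ n {t | Function.update x n t ∈ B} ≠ 0 := by
  have hT := measurePreserving_update_infinitePi μ n
  have hmeas : Measurable fun x : ∀ i, X i => μ n {t | Function.update x n t ∈ B} :=
    measurable_measure_prodMk_left (hT.measurable hB)
  set N : Set (∀ i, X i) := {x | x ∈ B ∧ μ n {t | Function.update x n t ∈ B} = 0} with hN
  have hNm : MeasurableSet N := hB.inter (hmeas (measurableSet_singleton 0))
  have h0 : Measure.infinitePi μ N = 0 := by
    rw [← hT.measure_preimage hNm.nullMeasurableSet,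
      Measure.measure_prod_null (hT.measurable hNm)]
    refine Eventually.of_forall fun x => ?_
    -- Whether a line parallel to the `n`-th axis meets `B` in a null set depends on the line only,
    -- since a second update overwrites the first. So every such line meets `N` in a null set.
    rcases Set.eq_empty_or_nonempty {t | Function.update x n t ∈ N} with h | ⟨t, ht⟩
    · exact (congrArg (μ n) h).trans measure_empty
    · refine measure_mono_null (fun s hs => ?_) ht.2
      have : Function.update x n s ∈ B := hs.1
      simpa using this
  rw [ae_iff]
  refine measure_mono_null (fun x hx => ?_) h0
  simpa [hN] using hx

/-- A set of positive measure contains a point whose lines parallel to the axes all meet the set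
again. -/
theorem exists_forall_update_mem [Countable ι] (hμ : ∀ i t, μ i {t} = 0) {B : Set (∀ i, X i)}
    (hB : NullMeasurableSet B (Measure.infinitePi μ)) (hpos : Measure.infinitePi μ B ≠ 0) :
    ∃ x ∈ B, ∀ n, ∃ t, t ≠ x n ∧ Function.update x n t ∈ B := by
  obtain ⟨B', hB'B, hB', hae⟩ := hB.exists_measurable_subset_ae_eq
  have hpos' : Measure.infinitePi μ B' ≠ 0 := by rwa [measure_congr hae]
  have hall := ae_all_iff.2 fun n => ae_measure_update_ne_zero μ n hB'
  obtain ⟨x, hx, hxB⟩ := (hall.and_frequently (frequently_ae_mem_iff.2 hpos')).exists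
  refine ⟨x, hB'B hxB, fun n => ?_⟩
  by_contra! hcon
  -- Otherwise the section is contained in the single point `x n`, a null set.
  refine hx n hxB (measure_mono_null (fun t ht => ?_) (hμ n (x n)))
  by_contra hne
  exact hcon t hne (hB'B ht)

end InfiniteProduct

/-! ### Linear algebra of boundary and interface conditions -/

theorem eIoo_mem_atLeftEnd {c d : EReal} (h : c < d) : eIoo c d ∈ atLeftEnd c :=
  preimage_mem_comap (Ioo_mem_nhdsGT h)

theorem eIoo_mem_atRightEnd {c d : EReal} (h : c < d) : eIoo c d ∈ atRightEnd d :=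
  preimage_mem_comap (Ioo_mem_nhdsLT h)

theorem eIoo_coe_coe (p q : ℝ) : eIoo p q = Set.Ioo p q := by
  ext t
  simp [eIoo]

/-- Three vectors in a plane are dependent, with the pairwise forms as coefficients. Thus two
solutions with nonzero form span all the others. -/
theorem symplecticForm_smul_eq (y z w : ℂ × ℂ) :
    symplecticForm y z • w = symplecticForm w z • y - symplecticForm w y • z := by
  ext <;> simp only [symplecticForm, Prod.smul_fst, Prod.smul_snd, Prod.fst_sub, Prod.snd_sub,
    smul_eq_mul] <;> ring

/-- If two curves in `ℂ²` are asymptotically skew-orthogonal to a curve that stays away from `0`,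
and their symplectic form is constant, then it vanishes. -/
theorem eq_zero_of_tendsto_symplecticForm {l : Filter ℝ} {U : Set ℝ} (hU : U ∈ l)
    {y z w : ℝ → ℂ × ℂ} {C : ℂ} (hC : ∀ s ∈ U, symplecticForm (y s) (z s) = C)
    (hy : ∀ s ∈ U, ∀ t ∈ U, ‖y t‖ ≤ 2 * ‖y s‖) (hz : ∀ s ∈ U, ∀ t ∈ U, ‖z t‖ ≤ 2 * ‖z s‖)
    (hw : ∀ s ∈ U, ∀ t ∈ U, ‖w t‖ ≤ 2 * ‖w s‖) (hw0 : ∃ᶠ t in l, w t ≠ 0)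
    (hwy : Tendsto (fun s => symplecticForm (w s) (y s)) l (𝓝 0))
    (hwz : Tendsto (fun s => symplecticForm (w s) (z s)) l (𝓝 0)) : C = 0 := by
  obtain ⟨t, ht0, htU⟩ := (hw0.and_eventually hU).exists
  have : l.NeBot := ⟨fun h => hw0 (by simp [h])⟩
  have hlim : Tendsto (fun s => 2 * (‖symplecticForm (w s) (z s)‖ * (2 * ‖y t‖)
      + ‖symplecticForm (w s) (y s)‖ * (2 * ‖z t‖))) l (𝓝 0) := by
    simpa using ((hwz.norm.mul_const (2 * ‖y t‖)).add (hwy.norm.mul_const (2 * ‖z t‖))).const_mul 2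
  have hle : ‖C‖ * ‖w t‖ ≤ 0 := by
    refine ge_of_tendsto hlim ?_
    filter_upwards [hU] with s hs
    calc ‖C‖ * ‖w t‖ ≤ ‖C‖ * (2 * ‖w s‖) := by
          gcongr
          exact hw s hs t htU
      _ = 2 * ‖C • w s‖ := by rw [norm_smul]; ring
      _ ≤ _ := by
          rw [← hC s hs, symplecticForm_smul_eq]
          gcongr
          refine (norm_sub_le _ _).trans ?_
          rw [norm_smul, norm_smul]
          gcongr
          · exact hy t htU s hs
          · exact hz t htU s hs
  have := norm_pos_iff.2 ht0
  exact norm_le_zero_iff.1 (nonpos_of_mul_nonpos_left hle this)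

/-- As `v` is real, so is its derivative, and the conjugations in the bracket have no effect. -/
theorem lagrangeBracket_ofReal {v : ℝ → ℝ} {g : ℝ → ℂ} {t : ℝ}
    (h : jet (fun s => (v s : ℂ)) t = ((v t : ℂ), deriv (fun s => (v s : ℂ)) t)) :
    lagrangeBracket (fun s => (v s : ℂ)) g t
      = symplecticForm (jet (fun s => (v s : ℂ)) t) (jet g t) := by
  obtain ⟨h1, h2⟩ := Prod.ext_iff.1 h
  simp only [jet] at h1 h2
  have h3 : (starRingEnd ℂ) (deriv (fun s => (v s : ℂ)) t) = deriv (fun s => (v s : ℂ)) t := by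
    rw [starRingEnd_apply, ← deriv.star]
    simp
  rw [lagrangeBracket, symplecticForm, jet, jet, h1, h2, h3, Complex.conj_ofReal]

theorem matrixAct_interactionMatrix (α r θ : ℝ) (y : ℂ × ℂ) :
    matrixAct (interactionMatrix α r θ) y =
      ((matrixAct (interactionMatrix 0 r θ) y).1 + α * (matrixAct (interactionMatrix 0 r θ) y).2,
        (matrixAct (interactionMatrix 0 r θ) y).2) := by
  simp only [matrixAct, interactionMatrix, parabolicMatrix, hyperbolicMatrix, ellipticMatrix,
    Matrix.mul_apply, Fin.sum_univ_two, Matrix.of_apply, Matrix.cons_val', Matrix.cons_val_zero,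
    Matrix.cons_val_one, Matrix.cons_val_fin_one]
  ext <;> push_cast <;> ring

/-- If `f'(p+) = 0`, the interface condition does not depend on the parabolic parameter. -/
theorem SatisfiesInterface.of_jet_snd_eq_zero {α r θ p : ℝ} {f : ℝ → ℂ}
    (h : SatisfiesInterface (interactionMatrix α r θ) p f) (h0 : (jet f p).2 = 0) (β : ℝ) :
    SatisfiesInterface (interactionMatrix β r θ) p f := by
  obtain ⟨l, r', h1, h2, h3, h4, h5⟩ := h
  refine ⟨l, r', h1, h2, h3, h4, ?_⟩
  have hr1 : r' 1 = 0 := (rightLim_eq_of_tendsto h4).symm.trans h0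
  have act : ∀ γ : ℝ, ((interactionMatrix γ r θ).map (fun s : ℝ => (s : ℂ))).mulVec l
      = ![(matrixAct (interactionMatrix γ r θ) (l 0, l 1)).1,
        (matrixAct (interactionMatrix γ r θ) (l 0, l 1)).2] := by
    intro γ
    ext i
    fin_cases i <;> simp [matrixAct, Matrix.mulVec, dotProduct, Fin.sum_univ_two]
  rw [h5, act, matrixAct_interactionMatrix] at hr1
  rw [h5, act, act, matrixAct_interactionMatrix, matrixAct_interactionMatrix β]
  simp only [Matrix.cons_val_one, Matrix.cons_val_fin_one] at hr1
  simp [hr1]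

/-- Two lines that are related by two different interface conditions force `f'(p+) = 0`. -/
theorem snd_eq_zero_of_symplecticForm_eq_zero {α β r θ : ℝ} (hαβ : α ≠ β)
    {y z : ℂ × ℂ} (hyz : symplecticForm y z = 0)
    (hyz' : symplecticForm (matrixAct (interactionMatrix α r θ) y)
      (matrixAct (interactionMatrix β r θ) z) = 0)
    (hz : matrixAct (interactionMatrix β r θ) z ≠ 0) :
    (matrixAct (interactionMatrix α r θ) y).2 = 0 := by
  have h0 := symplecticForm_matrixAct (interactionMatrix 0 r θ) y z
  rw [hyz, mul_zero] at h0
  rw [matrixAct_interactionMatrix] at hyz' ⊢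
  rw [matrixAct_interactionMatrix β] at hz hyz'
  set k := matrixAct (interactionMatrix 0 r θ) y
  set k' := matrixAct (interactionMatrix 0 r θ) z
  simp only [symplecticForm] at h0 hyz' ⊢
  have hne : (α : ℂ) - β ≠ 0 := by
    rw [sub_ne_zero]
    exact_mod_cast hαβ
  -- The form of the two sheared vectors exceeds that of `k` and `k'` by `(α - β) * (k.2 * k'.2)`.
  have hprod : k.2 * k'.2 = 0 := by
    refine (mul_eq_zero.1 ?_).resolve_left hne
    linear_combination hyz' - h0
  by_contra hk
  have hk' : k'.2 = 0 := (mul_eq_zero.1 hprod).resolve_left hk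
  have hk1 : k'.1 = 0 := by
    refine (mul_eq_zero.1 (?_ : k.2 * k'.1 = 0)).resolve_left hk
    rw [hk'] at h0
    linear_combination -h0
  exact hz (by simp [hk', hk1])

/-! ### Behaviour at the endpoints and comparison of two eigenfunctions -/

namespace PointInteractionData

variable {S : PointInteractionData} {Λ Λ' R Θ : S.I → ℝ} {z : ℂ} {c d : EReal}

theorem RegularLeft.exists_small (h : S.RegularLeft) (z : ℂ) (hc : S.a < c) :
    ∃ p q : ℝ, q ∈ eIoo S.a S.b ∧ eIoo S.a q = Set.Ioo p q ∧ Set.Ioo p q ⊆ eIoo S.a c \ S.M ∧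
      q - p ≤ 1 / 2 ∧ IntegrableOn (S.shiftedPotential z) (Set.Ioo p q) ∧
      ∫ x in Set.Ioo p q, ‖S.shiftedPotential z x‖ ≤ 1 / 4 := by
  obtain ⟨a₀, ha, hV, hacc⟩ := h
  obtain ⟨W, hW, hVW⟩ := hV a₀ (Set.mem_insert _ _)
  obtain ⟨ε, hε, hWε⟩ := Metric.mem_nhdsWithin_iff.1 hW
  obtain ⟨ε', hε', hMε⟩ := Metric.mem_nhdsWithin_iff.1 (eventually_notMem_M hacc)
  obtain ⟨q₁, hq₁, hq₁'⟩ := EReal.lt_iff_exists_real_btwn.1 (lt_min hc S.a_lt_b)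
  rw [ha, EReal.coe_lt_coe_iff] at hq₁
  obtain ⟨η, hη, h1, h2, h3⟩ : ∃ η : ℝ, 0 < η ∧ η ≤ ε ∧ η ≤ ε' ∧ η ≤ q₁ - a₀ :=
    ⟨min ε (min ε' (q₁ - a₀)), lt_min hε (lt_min hε' (by linarith)), min_le_left _ _,
      (min_le_right _ _).trans (min_le_left _ _), (min_le_right _ _).trans (min_le_right _ _)⟩
  have hlt : ∀ s : ℝ, s < a₀ + η → (s : EReal) < min c S.b := fun s hs =>
    (EReal.coe_lt_coe_iff.2 (by linarith : s < q₁)).trans hq₁'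
  have hball : ∀ s ∈ Set.Ioo a₀ (a₀ + η), dist s a₀ < η := fun s hs => by
    rw [Real.dist_eq, abs_of_pos (by linarith [hs.1])]
    linarith [hs.2]
  have hsub : Set.Ioo a₀ (a₀ + η) ⊆ W := fun s hs => hWε ⟨(hball s hs).trans_le h1,
    Or.inr ⟨by rw [ha]; exact_mod_cast hs.1, (hlt s hs.2).trans_le (min_le_right _ _)⟩⟩
  have hI : IntegrableOn (S.shiftedPotential z) (Set.Ioo a₀ (a₀ + η)) :=
    integrableOn_shiftedPotential (hVW.mono_set hsub) (by simp) z
  obtain ⟨δ, hδ, hsmall⟩ := hI.exists_forall_setIntegral_Ioo_le (ε := 1 / 4) (by norm_num)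
  -- The inequality `κ < η` is strict because `a₀ + κ` itself has to lie in the interval.
  obtain ⟨κ, hκ, h4, h5, h6⟩ : ∃ κ : ℝ, 0 < κ ∧ κ < η ∧ κ ≤ 1 / 2 ∧ κ < δ :=
    ⟨min (η / 2) (min (1 / 2) (δ / 2)), by positivity,
      (min_le_left _ _).trans_lt (by linarith),
      (min_le_right _ _).trans (min_le_left _ _),
      ((min_le_right _ _).trans (min_le_right _ _)).trans_lt (by linarith)⟩
  have hsub' : Set.Ioo a₀ (a₀ + κ) ⊆ Set.Ioo a₀ (a₀ + η) :=
    Set.Ioo_subset_Ioo_right (by linarith)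
  refine ⟨a₀, a₀ + κ, ⟨?_, ?_⟩, ?_, fun s hs => ⟨⟨?_, ?_⟩, ?_⟩, by linarith, hI.mono_set hsub',
    hsmall _ _ hsub' (by linarith)⟩
  · rw [ha, EReal.coe_lt_coe_iff]
    linarith
  · exact (hlt _ (by linarith)).trans_le (min_le_right _ _)
  · rw [ha, eIoo_coe_coe]
  · rw [ha]
    exact_mod_cast hs.1
  · exact (hlt s (hsub' hs).2).trans_le (min_le_left _ _)
  · exact hMε ⟨(hball s (hsub' hs)).trans_le h2, hs.1.ne'⟩

theorem RegularRight.exists_small (h : S.RegularRight) (z : ℂ) (hc : c < S.b) :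
    ∃ p q : ℝ, p ∈ eIoo S.a S.b ∧ eIoo p S.b = Set.Ioo p q ∧ Set.Ioo p q ⊆ eIoo c S.b \ S.M ∧
      q - p ≤ 1 / 2 ∧ IntegrableOn (S.shiftedPotential z) (Set.Ioo p q) ∧
      ∫ x in Set.Ioo p q, ‖S.shiftedPotential z x‖ ≤ 1 / 4 := by
  obtain ⟨b₀, hb, hV, hacc⟩ := h
  obtain ⟨W, hW, hVW⟩ := hV b₀ (Set.mem_insert _ _)
  obtain ⟨ε, hε, hWε⟩ := Metric.mem_nhdsWithin_iff.1 hW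
  obtain ⟨ε', hε', hMε⟩ := Metric.mem_nhdsWithin_iff.1 (eventually_notMem_M hacc)
  obtain ⟨q₁, hq₁', hq₁⟩ := EReal.lt_iff_exists_real_btwn.1 (max_lt hc S.a_lt_b)
  rw [hb, EReal.coe_lt_coe_iff] at hq₁
  obtain ⟨η, hη, h1, h2, h3⟩ : ∃ η : ℝ, 0 < η ∧ η ≤ ε ∧ η ≤ ε' ∧ η ≤ b₀ - q₁ :=
    ⟨min ε (min ε' (b₀ - q₁)), lt_min hε (lt_min hε' (by linarith)), min_le_left _ _,
      (min_le_right _ _).trans (min_le_left _ _), (min_le_right _ _).trans (min_le_right _ _)⟩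
  have hlt : ∀ s : ℝ, b₀ - η < s → max c S.a < (s : EReal) := fun s hs =>
    hq₁'.trans (EReal.coe_lt_coe_iff.2 (by linarith : q₁ < s))
  have hball : ∀ s ∈ Set.Ioo (b₀ - η) b₀, dist s b₀ < η := fun s hs => by
    rw [Real.dist_eq, abs_of_neg (by linarith [hs.2])]
    linarith [hs.1]
  have hsub : Set.Ioo (b₀ - η) b₀ ⊆ W := fun s hs => hWε ⟨(hball s hs).trans_le h1,
    Or.inr ⟨(le_max_right _ _).trans_lt (hlt s hs.1), by rw [hb]; exact_mod_cast hs.2⟩⟩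
  have hI : IntegrableOn (S.shiftedPotential z) (Set.Ioo (b₀ - η) b₀) :=
    integrableOn_shiftedPotential (hVW.mono_set hsub) (by simp) z
  obtain ⟨δ, hδ, hsmall⟩ := hI.exists_forall_setIntegral_Ioo_le (ε := 1 / 4) (by norm_num)
  obtain ⟨κ, hκ, h4, h5, h6⟩ : ∃ κ : ℝ, 0 < κ ∧ κ < η ∧ κ ≤ 1 / 2 ∧ κ < δ :=
    ⟨min (η / 2) (min (1 / 2) (δ / 2)), by positivity,
      (min_le_left _ _).trans_lt (by linarith),
      (min_le_right _ _).trans (min_le_left _ _),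
      ((min_le_right _ _).trans (min_le_right _ _)).trans_lt (by linarith)⟩
  have hsub' : Set.Ioo (b₀ - κ) b₀ ⊆ Set.Ioo (b₀ - η) b₀ :=
    Set.Ioo_subset_Ioo_left (by linarith)
  refine ⟨b₀ - κ, b₀, ⟨?_, ?_⟩, ?_, fun s hs => ⟨⟨?_, ?_⟩, ?_⟩, by linarith, hI.mono_set hsub',
    hsmall _ _ hsub' (by linarith)⟩
  · exact (le_max_right _ _).trans_lt (hlt _ (by linarith))
  · rw [hb, EReal.coe_lt_coe_iff]
    linarith
  · rw [hb, eIoo_coe_coe]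
  · exact (le_max_left _ _).trans_lt (hlt s (hsub' hs).1)
  · rw [hb]
    exact_mod_cast hs.2
  · exact hMε ⟨(hball s (hsub' hs)).trans_le h2, hs.2.ne⟩

theorem IsSolutionOn.memLp_of_norm_jet_le {f : ℝ → ℂ} (hf : S.IsSolutionOn Λ R Θ z c d f)
    (hcd : eIoo c d ⊆ eIoo S.a S.b) {p q : ℝ} (hU : Set.Ioo p q ⊆ eIoo c d \ S.M)
    (hle : ∀ s ∈ Set.Ioo p q, ∀ t ∈ Set.Ioo p q, ‖jet f t‖ ≤ 2 * ‖jet f s‖) :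
    MemLp f 2 (volume.restrict (Set.Ioo p q)) := by
  rcases Set.eq_empty_or_nonempty (Set.Ioo p q) with h | ⟨s, hs⟩
  · simp [h]
  have hcont : ContinuousOn f (Set.Ioo p q) := fun t ht =>
    (hf.continuousAt (hU ht).1 (hU ht).2).continuousWithinAt
  refine MemLp.of_bound (hcont.aestronglyMeasurable measurableSet_Ioo) (2 * ‖jet f s‖) ?_
  filter_upwards [ae_restrict_mem measurableSet_Ioo] with t ht
  refine le_trans ?_ (hle s hs t ht)
  rw [hf.jet_eq hcd (hU ht).1 (hU ht).2]
  exact norm_fst_le (f t, deriv f t)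

theorem RegularLeft.limitCircleLeft (h : S.RegularLeft) : S.LimitCircleLeft Λ R Θ := by
  intro z f hf
  obtain ⟨p, q, hq, he, hU, hlen, hI, hsmall⟩ := h.exists_small z S.a_lt_b
  refine ⟨q, hq, ?_⟩
  rw [he]
  exact hf.memLp_of_norm_jet_le subset_rfl hU fun s hs t ht =>
    hf.norm_jet_le subset_rfl hU hlen hI hsmall hs ht

theorem RegularRight.limitCircleRight (h : S.RegularRight) : S.LimitCircleRight Λ R Θ := by
  intro z f hf
  obtain ⟨p, q, hp, he, hU, hlen, hI, hsmall⟩ := h.exists_small z S.a_lt_b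
  refine ⟨p, hp, ?_⟩
  rw [he]
  exact hf.memLp_of_norm_jet_le subset_rfl hU fun s hs t ht =>
    hf.norm_jet_le subset_rfl hU hlen hI hsmall hs ht

theorem LimitPointLeft.not_limitCircleLeft (h : S.LimitPointLeft Λ R Θ) :
    ¬ S.LimitCircleLeft Λ R Θ := fun hc => by
  obtain ⟨f, hf, hf'⟩ := h 0
  exact hf' (hc 0 f hf)

theorem LimitPointRight.not_limitCircleRight (h : S.LimitPointRight Λ R Θ) :
    ¬ S.LimitCircleRight Λ R Θ := fun hc => by
  obtain ⟨f, hf, hf'⟩ := h 0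
  exact hf' (hc 0 f hf)

/-- A solution is a combination of two independent ones, so it is square integrable if they are. -/
theorem IsSolutionOn.memLp_of_symplecticForm_ne_zero (hR : ∀ n, 0 < R n) {f g h : ℝ → ℂ}
    (hcd : eIoo c d ⊆ eIoo S.a S.b) (hf : S.IsSolutionOn Λ R Θ z c d f)
    (hg : S.IsSolutionOn Λ R Θ z c d g) (hh : S.IsSolutionOn Λ R Θ z c d h)
    (hf2 : MemLp f 2 (volume.restrict (eIoo c d))) (hg2 : MemLp g 2 (volume.restrict (eIoo c d)))
    {t : ℝ} (ht : t ∈ eIoo c d) (hne : symplecticForm (jet f t) (jet g t) ≠ 0) :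
    MemLp h 2 (volume.restrict (eIoo c d)) := by
  set C := symplecticForm (jet f t) (jet g t) with hC
  refine MemLp.ae_eq ?_ ((hf2.const_mul (C⁻¹ * symplecticForm (jet h t) (jet g t))).sub
    (hg2.const_mul (C⁻¹ * symplecticForm (jet h t) (jet f t))))
  filter_upwards [ae_restrict_mem (measurableSet_eIoo c d),
    ae_restrict_of_ae ((countable_M (S := S)).ae_notMem volume)] with s hs hsM
  have key := symplecticForm_smul_eq (jet f s) (jet g s) (jet h s)
  rw [hf.symplecticForm_eq hR hg hcd hs ht, hh.symplecticForm_eq hR hg hcd hs ht,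
    hh.symplecticForm_eq hR hf hcd hs ht, ← hC, hf.jet_eq hcd hs hsM, hg.jet_eq hcd hs hsM,
    hh.jet_eq hcd hs hsM] at key
  have key' := congrArg Prod.fst key
  simp only [Prod.smul_fst, Prod.fst_sub, smul_eq_mul] at key'
  simp only [Pi.sub_apply]
  rw [mul_assoc, mul_assoc, ← mul_sub, ← key', inv_mul_cancel_left₀ hne]

/-- At a regular endpoint both solutions become skew-orthogonal to `v`, whose jet stays away from
zero, so they are proportional. In the limit point case two independent square integrable solutions
would span the solution space and make every solution square integrable. Both solve the equation for
`Λ` on this side; `Λ'` enters only through the boundary condition of `g`. -/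
theorem symplecticForm_eq_zero_left (hR : ∀ n, 0 < R n) {v : ℝ → ℝ}
    (hleft : (S.RegularLeft ∧ ∀ Λ, S.IsBoundarySolutionLeft Λ R Θ v) ∨
      ∀ Λ, S.LimitPointLeft Λ R Θ) {p : ℝ} (hp : p ∈ eIoo S.a S.b) {f g : ℝ → ℂ}
    (hf : S.IsSolutionOn Λ R Θ z S.a p f) (hg : S.IsSolutionOn Λ R Θ z S.a p g)
    (hf2 : MemLp f 2 (volume.restrict (eIoo S.a p)))
    (hg2 : MemLp g 2 (volume.restrict (eIoo S.a p)))
    (hfv : S.LimitCircleLeft Λ R Θ →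
      Tendsto (lagrangeBracket (fun t => (v t : ℂ)) f) (atLeftEnd S.a) (𝓝 0))
    (hgv : S.LimitCircleLeft Λ' R Θ →
      Tendsto (lagrangeBracket (fun t => (v t : ℂ)) g) (atLeftEnd S.a) (𝓝 0))
    {t : ℝ} (ht : t ∈ eIoo S.a p) : symplecticForm (jet f t) (jet g t) = 0 := by
  have hsub : eIoo S.a p ⊆ eIoo S.a S.b := eIoo_subset_eIoo le_rfl hp.2.le
  rcases hleft with ⟨hreg, hv⟩ | hlp
  · obtain ⟨⟨l, c, hc, hvs⟩, hfreq⟩ := hv Λ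
    have hsubc : eIoo S.a c ⊆ eIoo S.a S.b := eIoo_subset_eIoo le_rfl hc.2.le
    obtain ⟨p₁, q₁, hq₁, he₁, hU₁, hlen₁, hI₁, hsmall₁⟩ := hreg.exists_small l hc.1
    obtain ⟨p₂, q₂, hq₂, he₂, hU₂, hlen₂, hI₂, hsmall₂⟩ := hreg.exists_small z hp.1
    have hm₁ := he₁ ▸ eIoo_mem_atLeftEnd hq₁.1
    have hm₂ := he₂ ▸ eIoo_mem_atLeftEnd hq₂.1
    have hjv : ∀ s ∈ Set.Ioo p₁ q₁, jet (fun s => (v s : ℂ)) s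
        = ((v s : ℂ), deriv (fun s => (v s : ℂ)) s) := fun s hs =>
      hvs.jet_eq hsubc (hU₁ hs).1 (hU₁ hs).2
    have hbr : ∀ g : ℝ → ℂ, Tendsto (lagrangeBracket (fun t => (v t : ℂ)) g) (atLeftEnd S.a) (𝓝 0) →
        Tendsto (fun s => symplecticForm (jet (fun t => (v t : ℂ)) s) (jet g s))
          (atLeftEnd S.a) (𝓝 0) := fun g hg => hg.congr' <| by
      filter_upwards [hm₁] with s hs using lagrangeBracket_ofReal (hjv s hs)
    refine eq_zero_of_tendsto_symplecticForm (inter_mem hm₁ hm₂)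
      (fun s hs => hf.symplecticForm_eq hR hg hsub (hU₂ hs.2).1 ht)
      (fun s hs t ht => hf.norm_jet_le hsub hU₂ hlen₂ hI₂ hsmall₂ hs.2 ht.2)
      (fun s hs t ht => hg.norm_jet_le hsub hU₂ hlen₂ hI₂ hsmall₂ hs.2 ht.2)
      (fun s hs t ht => hvs.norm_jet_le hsubc hU₁ hlen₁ hI₁ hsmall₁ hs.1 ht.1) ?_
      (hbr f (hfv hreg.limitCircleLeft)) (hbr g (hgv hreg.limitCircleLeft))
    refine (hfreq.and_eventually hm₁).mono fun s hs h0 => hs.1.2 ?_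
    rw [hjv s hs.2] at h0
    exact Complex.ofReal_eq_zero.1 (congrArg Prod.fst h0)
  · by_contra hne
    obtain ⟨h, hh, hh'⟩ := hlp Λ z
    exact hh' ⟨p, hp, IsSolutionOn.memLp_of_symplecticForm_ne_zero hR hsub hf hg
      (hh.mono hsub fun _ _ => rfl) hf2 hg2 ht hne⟩

theorem symplecticForm_eq_zero_right (hR : ∀ n, 0 < R n) {w : ℝ → ℝ}
    (hright : (S.RegularRight ∧ ∀ Λ, S.IsBoundarySolutionRight Λ R Θ w) ∨
      ∀ Λ, S.LimitPointRight Λ R Θ) {p : ℝ} (hp : p ∈ eIoo S.a S.b) {f g : ℝ → ℂ}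
    (hf : S.IsSolutionOn Λ R Θ z p S.b f) (hg : S.IsSolutionOn Λ R Θ z p S.b g)
    (hf2 : MemLp f 2 (volume.restrict (eIoo p S.b)))
    (hg2 : MemLp g 2 (volume.restrict (eIoo p S.b)))
    (hfw : S.LimitCircleRight Λ R Θ →
      Tendsto (lagrangeBracket (fun t => (w t : ℂ)) f) (atRightEnd S.b) (𝓝 0))
    (hgw : S.LimitCircleRight Λ' R Θ →
      Tendsto (lagrangeBracket (fun t => (w t : ℂ)) g) (atRightEnd S.b) (𝓝 0))
    {t : ℝ} (ht : t ∈ eIoo p S.b) : symplecticForm (jet f t) (jet g t) = 0 := by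
  have hsub : eIoo p S.b ⊆ eIoo S.a S.b := eIoo_subset_eIoo hp.1.le le_rfl
  rcases hright with ⟨hreg, hw⟩ | hlp
  · obtain ⟨⟨l, c, hc, hws⟩, hfreq⟩ := hw Λ
    have hsubc : eIoo c S.b ⊆ eIoo S.a S.b := eIoo_subset_eIoo hc.1.le le_rfl
    obtain ⟨p₁, q₁, hq₁, he₁, hU₁, hlen₁, hI₁, hsmall₁⟩ := hreg.exists_small l hc.2
    obtain ⟨p₂, q₂, hq₂, he₂, hU₂, hlen₂, hI₂, hsmall₂⟩ := hreg.exists_small z hp.2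
    have hm₁ := he₁ ▸ eIoo_mem_atRightEnd hq₁.2
    have hm₂ := he₂ ▸ eIoo_mem_atRightEnd hq₂.2
    have hjw : ∀ s ∈ Set.Ioo p₁ q₁, jet (fun s => (w s : ℂ)) s
        = ((w s : ℂ), deriv (fun s => (w s : ℂ)) s) := fun s hs =>
      hws.jet_eq hsubc (hU₁ hs).1 (hU₁ hs).2
    have hbr : ∀ g : ℝ → ℂ,
        Tendsto (lagrangeBracket (fun t => (w t : ℂ)) g) (atRightEnd S.b) (𝓝 0) →
        Tendsto (fun s => symplecticForm (jet (fun t => (w t : ℂ)) s) (jet g s))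
          (atRightEnd S.b) (𝓝 0) := fun g hg => hg.congr' <| by
      filter_upwards [hm₁] with s hs using lagrangeBracket_ofReal (hjw s hs)
    refine eq_zero_of_tendsto_symplecticForm (inter_mem hm₁ hm₂)
      (fun s hs => hf.symplecticForm_eq hR hg hsub (hU₂ hs.2).1 ht)
      (fun s hs t ht => hf.norm_jet_le hsub hU₂ hlen₂ hI₂ hsmall₂ hs.2 ht.2)
      (fun s hs t ht => hg.norm_jet_le hsub hU₂ hlen₂ hI₂ hsmall₂ hs.2 ht.2)
      (fun s hs t ht => hws.norm_jet_le hsubc hU₁ hlen₁ hI₁ hsmall₁ hs.1 ht.1) ?_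
      (hbr f (hfw hreg.limitCircleRight)) (hbr g (hgw hreg.limitCircleRight))
    refine (hfreq.and_eventually hm₁).mono fun s hs h0 => hs.1.2 ?_
    rw [hjw s hs.2] at h0
    exact Complex.ofReal_eq_zero.1 (congrArg Prod.fst h0)
  · by_contra hne
    obtain ⟨h, hh, hh'⟩ := hlp Λ z
    exact hh' ⟨p, hp, IsSolutionOn.memLp_of_symplecticForm_ne_zero hR hsub hf hg
      (hh.mono hsub fun _ _ => rfl) hf2 hg2 ht hne⟩

theorem isSolutionOn_of_mem_maximalDomain {u : ℝ → ℂ} (hu : u ∈ S.maximalDomain Λ R Θ)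
    (he : S.tau u =ᵐ[volume.restrict (eIoo S.a S.b)] fun t => z * u t) :
    S.IsSolutionOn Λ R Θ z S.a S.b u :=
  ⟨hu.2.1, he.mono fun _ ht => sub_eq_zero.2 ht, hu.2.2.2⟩

/-- If `E` is an eigenvalue for two parameters that differ only at `n`, then the eigenfunctions
have vanishing derivative at `x n +`. -/
theorem jet_snd_eq_zero (hR : ∀ n, 0 < R n) {v w : ℝ → ℝ}
    (hleft : (S.RegularLeft ∧ ∀ Λ, S.IsBoundarySolutionLeft Λ R Θ v) ∨
      ∀ Λ, S.LimitPointLeft Λ R Θ)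
    (hright : (S.RegularRight ∧ ∀ Λ, S.IsBoundarySolutionRight Λ R Θ w) ∨
      ∀ Λ, S.LimitPointRight Λ R Θ) {E : ℝ} {u u' : ℝ → ℂ}
    (hu : u ∈ S.operatorDomain v w Λ R Θ)
    (hue : S.tau u =ᵐ[volume.restrict (eIoo S.a S.b)] fun t => (E : ℂ) * u t)
    (hu' : u' ∈ S.operatorDomain v w Λ' R Θ)
    (hue' : S.tau u' =ᵐ[volume.restrict (eIoo S.a S.b)] fun t => (E : ℂ) * u' t)
    (hu'0 : ¬ (u' =ᵐ[volume.restrict (eIoo S.a S.b)] 0)) (n : S.I)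
    (hΛ : ∀ m, m ≠ n → Λ' m = Λ m) (hn : Λ n ≠ Λ' n) : (jet u (S.x n)).2 = 0 := by
  have hx := S.x_mem n
  have hs := isSolutionOn_of_mem_maximalDomain hu.1 hue
  have hs' := isSolutionOn_of_mem_maximalDomain hu'.1 hue'
  have hsubl : eIoo S.a (S.x n) ⊆ eIoo S.a S.b := eIoo_subset_eIoo le_rfl hx.2.le
  have hsubr : eIoo (S.x n) S.b ⊆ eIoo S.a S.b := eIoo_subset_eIoo hx.1.le le_rfl
  have hl : ∀ t ∈ eIoo S.a (S.x n), symplecticForm (jet u t) (jet u' t) = 0 := fun t ht =>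
    symplecticForm_eq_zero_left hR hleft hx (hs.mono hsubl fun _ _ => rfl)
      -- The open interval omits `x n`, the only point where the parameters differ, so `u'` also
      -- solves the equation for `Λ` there.
      (hs'.mono hsubl fun m hm => hΛ m fun h => lt_irrefl _ (h ▸ hm.2))
      (hu.1.1.mono_measure (Measure.restrict_mono_set _ hsubl))
      (hu'.1.1.mono_measure (Measure.restrict_mono_set _ hsubl)) hu.2.1 hu'.2.1 ht
  have hr : ∀ t ∈ eIoo (S.x n) S.b, symplecticForm (jet u t) (jet u' t) = 0 := fun t ht =>
    symplecticForm_eq_zero_right hR hright hx (hs.mono hsubr fun _ _ => rfl)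
      (hs'.mono hsubr fun m hm => hΛ m fun h => lt_irrefl _ (h ▸ hm.1))
      (hu.1.1.mono_measure (Measure.restrict_mono_set _ hsubr))
      (hu'.1.1.mono_measure (Measure.restrict_mono_set _ hsubr)) hu.2.2 hu'.2.2 ht
  obtain ⟨y, hy1, hy2, hy3⟩ := hs.exists_tendsto_jet subset_rfl hx (hs.2.2 n hx)
  obtain ⟨y', hy1', hy2', hy3'⟩ := hs'.exists_tendsto_jet subset_rfl hx (hs'.2.2 n hx)
  have hle : eIoo S.a (S.x n) ∈ 𝓝[<] (S.x n) := by
    filter_upwards [self_mem_nhdsWithin, nhdsWithin_le_nhds ((isOpen_eIoo _ _).mem_nhds hx)]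
      with t ht ht' using ⟨ht'.1, by exact_mod_cast ht⟩
  have hge : eIoo (S.x n) S.b ∈ 𝓝[>] (S.x n) := by
    filter_upwards [self_mem_nhdsWithin, nhdsWithin_le_nhds ((isOpen_eIoo _ _).mem_nhds hx)]
      with t ht ht' using ⟨by exact_mod_cast ht, ht'.2⟩
  have h1 : symplecticForm y y' = 0 := by
    refine tendsto_nhds_unique (hy1.symplecticForm hy1') (tendsto_const_nhds.congr' ?_)
    filter_upwards [hle] with t ht using (hl t ht).symm
  have h2 : symplecticForm (jet u (S.x n)) (jet u' (S.x n)) = 0 := by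
    refine tendsto_nhds_unique (hy2.symplecticForm hy2') (tendsto_const_nhds.congr' ?_)
    filter_upwards [hge] with t ht using (hr t ht).symm
  have h3 : jet u' (S.x n) ≠ 0 := fun h => hu'0 (hs'.ae_eq_zero hR subset_rfl hx h)
  rw [hy3, hy3'] at h2
  rw [hy3'] at h3
  rw [hy3]
  exact snd_eq_zero_of_symplecticForm_eq_zero hn h1 h2 h3

end PointInteractionData

theorem mainTheorem1 (S : PointInteractionData)
    (R Θ : S.I → ℝ) (hR : ∀ n, 0 < R n)
    (v w : ℝ → ℝ)
    (hleft : (S.RegularLeft ∧ ∀ Λ, S.IsBoundarySolutionLeft Λ R Θ v) ∨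
      ∀ Λ, S.LimitPointLeft Λ R Θ)
    (hright : (S.RegularRight ∧ ∀ Λ, S.IsBoundarySolutionRight Λ R Θ w) ∨
      ∀ Λ, S.LimitPointRight Λ R Θ)
    (p : S.I → Measure ℝ) [∀ n, IsProbabilityMeasure (p n)]
    (hp : ∀ n t, p n {t} = 0)
    (E : ℝ) (B : Set (S.I → ℝ))
    -- measurability with respect to the completed product σ-algebra
    (hB : NullMeasurableSet B (Measure.infinitePi p))
    (hBE : B ⊆ S.eigenvalueSet v w R Θ E) :
    Measure.infinitePi p B = 0 ∨ S.eigenvalueSet v w R Θ E = Set.univ := by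
  rcases eq_or_ne (Measure.infinitePi p B) 0 with h0 | hpos
  · exact Or.inl h0
  refine Or.inr (Set.eq_univ_of_forall fun Λ' => ?_)
  obtain ⟨Λ, hΛ, hupd⟩ := exists_forall_update_mem p hp hB hpos
  obtain ⟨u, hu, hu0, hue⟩ := hBE hΛ
  have hzero : ∀ n, (jet u (S.x n)).2 = 0 := fun n => by
    obtain ⟨t, htn, ht⟩ := hupd n
    obtain ⟨u', hu', hu'0, hue'⟩ := hBE ht
    exact S.jet_snd_eq_zero hR hleft hright hu hue hu' hue' hu'0 n
      (fun m hm => Function.update_of_ne hm _ _) (by simpa using htn.symm)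
  refine ⟨u, ⟨⟨hu.1.1, hu.1.2.1, hu.1.2.2.1, fun n hn => ?_⟩, fun hlc => ?_, fun hlc => ?_⟩,
    hu0, hue⟩
  -- The same `u` serves for `Λ'`: only the interface and boundary conditions mention the parameter,
  -- and the endpoint classification is the same for every parameter.
  · exact (hu.1.2.2.2 n hn).of_jet_snd_eq_zero (hzero n) _
  · rcases hleft with ⟨hreg, -⟩ | hlp
    · exact hu.2.1 hreg.limitCircleLeft
    · exact absurd hlc (hlp Λ').not_limitCircleLeft
  · rcases hright with ⟨hreg, -⟩ | hlp
    · exact hu.2.2 hreg.limitCircleRight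
    · exact absurd hlc (hlp Λ').not_limitCircleRight
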